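/- Let $\mathbb K$ be a field of characteristic $0$, let $\mathcal I$ be a finite set of letters and let $\mathbf d=(d_x)_{x\in\mathcal I}$ be a tuple of non-negative integers. Let $\mathbb K[V_{\mathcal I,\mathbf d}]$ be the polynomial ring in the variables $x_0,\dots,x_{d_x}$, $x\in\mathcal I$, graded by multidegree in $\mathbb N^{\mathcal I}$, and let $\mathcal D_{\mathbf d}$ be the Weitzenböck derivation $\mathcal D_{\mathbf d}(x_0)=0$, $\mathcal D_{\mathbf d}(x_i)=x_{i-1}$ for $1\le i\le d_x$. Put $\mathcal N_{\mathcal I}=\mathbb K[x_0\mid x\in\mathcal I]$. For a finite set $\mathcal J$ of symbol letters, a symbolic expression in $\mathcal J$ is a polynomial in formal variables $[\alpha,\beta]$ ($\alpha\ne\beta$ in $\mathcal J$) and $\gamma_0$ ($\gamma\in\mathcal J$). It is evaluated in $\mathbb K[\alpha_0,\alpha_1\mid\alpha\in\mathcal J]$ by $[\alpha,\beta]=\alpha_0\beta_1-\alpha_1\beta_0$. Its weight in $\mathbb N^{\mathcal J}$ counts the occurrences of each letter. The convolution with respect to $\alpha\neq\beta$ is the operator $[\alpha,\beta]\,\partial^2/\partial\alpha_0\partial\beta_0$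 on symbolic expressions, in which the brackets are treated as constants. The convolutions of $P$ are the expressions obtained from $P$ by finitely many (possibly zero) such operators. For a map $\varphi:\mathcal J\to\mathcal I$ let $\Lambda=\Lambda_\varphi$ be the linear map on polynomials of weight $(d_{\varphi(\alpha)})_{\alpha\in\mathcal J}$ given by $$\Lambda\Bigl(\prod_{\alpha}\alpha_0^{d_{\varphi(\alpha)}-i_\alpha}\alpha_1^{i_\alpha}\Bigr)=\prod_\alpha i_\alpha!\,\varphi(\alpha)_{i_\alpha},\qquad 0\le i_\alpha\le d_{\varphi(\alpha)},$$ and apply $\Lambda$ to symbolic expressions of this weight through their evaluation. If $P$ is a symbolic expression of this weight with $\Lambda(P)=F$ (a symbolic representation of $F$) and $Q$ is a convolution of $P$, then $\Lambda(Q)$ is called a $\Lambda$-convolution of $F$. For a subalgebra $T$ let $\mathrm{Conv}_\Lambda(T)$ be the algebra generated by all $\Lambda$-convolutions of all elements of $T$. **Theorem.** (1) $\ker\mathcal D_{\mathbf d}=\mathrm{Conv}_\Lambda(\mathcal N_{\mathcal I})$. (2) The algebra $\ker\mathcal D_{\mathbf d}$ is already generated by the elements $\Lambda_\varphi(Q)$,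 where $\mathcal J$ is a finite set, $\varphi:\mathcal J\to\mathcal I$ is a map, and $Q$ is a convolution of the product $\prod_{\alpha\in\mathcal J}\alpha_0^{d_{\varphi(\alpha)}}$. (3) For every $F\in\ker\mathcal D_{\mathbf d}$, every finite $\mathcal J$ and every $\varphi:\mathcal J\to\mathcal I$, the component of $F$ of multidegree $(|\varphi^{-1}(x)|)_{x\in\mathcal I}$ equals $\Lambda_\varphi(\Phi)$ for some $\mathbb K$-linear combination $\Phi$ of convolutions of $\prod_{\alpha\in\mathcal J}\alpha_0^{d_{\varphi(\alpha)}}$. (Every multidegree arises from some $\varphi$.) -/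

import Mathlib

namespace Weitzenboeck

open MvPolynomial

/-- The variables `x_0, …, x_{d i}` of the `i`-th letter `x`, for all letters `i : Fin s`. -/
abbrev Var {s : ℕ} (d : Fin s → ℕ) : Type := Σ i : Fin s, Fin (d i + 1)

/-- The Weitzenböck derivation with Jordan blocks of sizes `d i + 1`:
`x_0 ↦ 0` and `x_{j+1} ↦ x_j` for every letter `x`. -/
noncomputable def derivation (K : Type*) [Field K] {s : ℕ} (d : Fin s → ℕ) :
    Derivation K (MvPolynomial (Var d) K) (MvPolynomial (Var d) K) :=
  mkDerivation K fun v =>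
    Fin.cases (motive := fun _ => MvPolynomial (Var d) K) 0
      (fun j => X ⟨v.1, j.castSucc⟩) v.2

/-- The kernel of the Weitzenböck derivation, as a subalgebra. -/
noncomputable def kernel (K : Type*) [Field K] {s : ℕ} (d : Fin s → ℕ) :
    Subalgebra K (MvPolynomial (Var d) K) where
  carrier := {F | derivation K d F = 0}
  mul_mem' := by
    intro a b ha hb
    simp only [Set.mem_ofPred_eq] at ha hb ⊢
    simp [Derivation.leibniz, ha, hb]
  add_mem' := by
    intro a b ha hb
    simp only [Set.mem_ofPred_eq] at ha hb ⊢
    simp [ha, hb]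
  algebraMap_mem' := by
    intro r
    simp

/-- The polynomial subalgebra generated by the variables `x_0`, one for every letter `x`. -/
noncomputable def leadingAlgebra (K : Type*) [Field K] {s : ℕ} (d : Fin s → ℕ) :
    Subalgebra K (MvPolynomial (Var d) K) :=
  Algebra.adjoin K (Set.range fun i : Fin s => X ⟨i, 0⟩)

/-- The multidegree of a variable: degree one in its own letter. -/
def multidegree {s : ℕ} (d : Fin s → ℕ) (v : Var d) : Fin s → ℕ :=
  Pi.single v.1 1

/-- The indeterminates of the algebra of symbolic expressions in the symbol letters `J`:
a formal bracket `[α, β]` for every ordered pair of distinct letters (`Sum.inl`), and a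
formal `γ_0` for every letter (`Sum.inr`). -/
abbrev SymbolVar (J : Type*) : Type _ := {p : J × J // p.1 ≠ p.2} ⊕ J

/-- Symbolic expressions: the free commutative algebra on the formal brackets `[α, β]` and the
formal `γ_0`. -/
abbrev SymbolicExpr (K J : Type*) [Field K] : Type _ := MvPolynomial (SymbolVar J) K

/-- The weight of an indeterminate: it counts the occurrences of every symbol letter. -/
def symbolWeight {J : Type*} [DecidableEq J] : SymbolVar J → J → ℕ
  | Sum.inl p => Pi.single p.1.1 1 + Pi.single p.1.2 1
  | Sum.inr γ => Pi.single γ 1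

/-- The evaluation of symbolic expressions in the polynomial ring in the variables `α_0, α_1`
for `α ∈ J`: `[α, β] ↦ α_0 β_1 - α_1 β_0` and `γ_0 ↦ γ_0`. -/
noncomputable def evalSymbol (K J : Type*) [Field K] :
    SymbolicExpr K J →ₐ[K] MvPolynomial (J × Fin 2) K :=
  aeval fun v => match v with
    | Sum.inl p => X (p.1.1, 0) * X (p.1.2, 1) - X (p.1.1, 1) * X (p.1.2, 0)
    | Sum.inr γ => X (γ, 0)

/-- The convolution `[α, β] ∂²/∂α_0 ∂β_0` of symbolic expressions; the brackets are constants
for the two partial derivatives. -/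
noncomputable def conv {K J : Type*} [Field K] (α β : J) (h : α ≠ β) (P : SymbolicExpr K J) :
    SymbolicExpr K J :=
  X (Sum.inl ⟨(α, β), h⟩) * pderiv (Sum.inr α) (pderiv (Sum.inr β) P)

/-- `Q` is a convolution of `P`: it results from `P` by finitely many (possibly no)
convolutions with respect to pairs of symbol letters. -/
def IsConvolution {K J : Type*} [Field K] (P Q : SymbolicExpr K J) : Prop :=
  Relation.ReflTransGen
    (fun A B : SymbolicExpr K J => ∃ (α β : J) (h : α ≠ β), B = conv α β h A) P Q

/-- The variable `x_j` of the `i`-th letter `x`, and `0` if `j > d i`. -/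
noncomputable def letterVar (K : Type*) [Field K] {s : ℕ} (d : Fin s → ℕ) (i : Fin s) (j : ℕ) :
    MvPolynomial (Var d) K :=
  if h : j < d i + 1 then X ⟨i, ⟨j, h⟩⟩ else 0

/-- The map `Λ`, for an assignment `φ` of letters to the symbol letters. It is the linear map
that sends a monomial `∏ α_0 ^ (d (φ α) - j α) * α_1 ^ (j α)` to `∏ (j α)! • (φ α)_{j α}`.
It is meant for polynomials of weight `d ∘ φ` in the symbol letters, which are linear
combinations of exactly these monomials. -/
noncomputable def lambdaMap {K J : Type*} [Field K] [Fintype J] {s : ℕ} (d : Fin s → ℕ)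
    (φ : J → Fin s) : MvPolynomial (J × Fin 2) K →ₗ[K] MvPolynomial (Var d) K :=
  (basisMonomials (J × Fin 2) K).constr K fun e =>
    ∏ α : J, ((e (α, 1)).factorial : K) • letterVar K d (φ α) (e (α, 1))

/-- `G` is a `Λ`-convolution of `F`: `F` has a symbolic representation `P`, in finitely many
symbol letters to which letters are assigned by `φ`, such that `G` is the `Λ`-image of a
convolution of `P`. -/
def IsLambdaConvolution {K : Type*} [Field K] {s : ℕ} (d : Fin s → ℕ)
    (F G : MvPolynomial (Var d) K) : Prop :=
  ∃ (n : ℕ) (φ : Fin n → Fin s) (P Q : SymbolicExpr K (Fin n)),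
    IsWeightedHomogeneous symbolWeight P (d ∘ φ) ∧
    lambdaMap d φ (evalSymbol K (Fin n) P) = F ∧
    IsConvolution P Q ∧
    lambdaMap d φ (evalSymbol K (Fin n) Q) = G

/-- The algebra generated by the `Λ`-convolutions of all elements of a subalgebra `T`. -/
noncomputable def lambdaConvAlgebra {K : Type*} [Field K] {s : ℕ} (d : Fin s → ℕ)
    (T : Subalgebra K (MvPolynomial (Var d) K)) : Subalgebra K (MvPolynomial (Var d) K) :=
  Algebra.adjoin K {G | ∃ F ∈ T, IsLambdaConvolution d F G}

/-- The symbolic expression `∏ α_0 ^ d (φ α)`, a product of the `α_0`; its `Λ`-image is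
the product of the variables `(φ α)_0`. -/
noncomputable def leadingSymbol (K : Type*) {J : Type*} [Field K] [Fintype J] {s : ℕ}
    (d : Fin s → ℕ) (φ : J → Fin s) : SymbolicExpr K J :=
  ∏ α : J, X (Sum.inr α) ^ d (φ α)

end Weitzenboeck

open MvPolynomial

/-! ### Derivations and weighted homogeneous polynomials -/

namespace MvPolynomial

variable {R M σ : Type*} [CommRing R] [AddCommMonoid M]

/-! The map Λ carries the derivation `raising` (`α_1 ↦ α_0 ↦ 0` in all symbol letters) to the
Weitzenböck derivation (`derivation_lambdaMap`). Evaluated brackets and `γ_0` are killed by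
`raising`, and convolutions preserve the weight, so every Λ-convolution lies in the kernel.

Conversely, Λ is inverted on a multihomogeneous component by `polarize`, up to the factor `∏ c_i!`
(`lambdaMap_monomial_mul_polarize`, iterating Euler's identity). Polarization also intertwines the
two derivations (`raising_polarize`), so it sends an `F` in the kernel to a constant of `raising`.
By a first fundamental theorem for the unipotent group (`mem_evalSubmodule_of_raising_eq_zero`),
this constant is a polynomial in brackets and `α_0`, of weight `d ∘ φ`. Each monomial of this weight
in the formal symbols is a nonzero scalar multiple of a convolution of `∏ α_0 ^ d (φ α)`: expand its
brackets `[α, β]` back to `α_0 β_0` one by one (`exists_isConvolution_monomial`). This is the third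
claim. Summing over multidegrees gives the second, and the first lies between the two inclusions.

The fundamental theorem is proved by induction on the degree. Modulo `α_0`, a constant `f` of degree
`k` in `α` is `α_1 ^ k * g` with `g` a constant free of `α`. If `f` has weight at least 0, then `g`
contains at least `k` factors `γ_0` in each term, and turning `k` of them into `[γ, α]` realises
`α_1 ^ k * g` modulo `α_0`. The difference is `α_0` times a constant of lower degree. Negative
weight is excluded by `sl₂`-theory (`eq_zero_of_raising_eq_zero`). -/

theorem IsWeightedHomogeneous.derivation {w : σ → M} {c m : M} {f : MvPolynomial σ R}
    (D : Derivation R (MvPolynomial σ R) (MvPolynomial σ R))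
    (hD : ∀ i, IsWeightedHomogeneous w (D (X i)) (w i + c)) (hf : IsWeightedHomogeneous w f m) :
    IsWeightedHomogeneous w (D f) (m + c) := by
  have hmk : D = mkDerivation R fun i => D (X i) := derivation_ext fun i => by simp
  induction hf using IsWeightedHomogeneous.induction_on with
  | zero => simpa using isWeightedHomogeneous_zero R w _
  | add p q _ _ hp hq => simpa using hp.add hq
  | monomial e r he =>
    rw [hmk, mkDerivation_monomial]
    refine (weightedHomogeneousSubmodule R w (m + c)).smul_mem _
      (Submodule.sum_mem _ fun i hi => ?_)
    rw [mem_weightedHomogeneousSubmodule]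
    have h := (isWeightedHomogeneous_monomial w (e - Finsupp.single i 1) (e i : R) rfl).mul (hD i)
    rw [← add_assoc, Finsupp.weight_sub_single_add (Finsupp.mem_support_iff.mp hi), he] at h
    exact h

theorem weightedHomogeneousComponent_derivation [IsRightCancelAdd M] {w : σ → M} {c : M}
    (D : Derivation R (MvPolynomial σ R) (MvPolynomial σ R))
    (hD : ∀ i, IsWeightedHomogeneous w (D (X i)) (w i + c)) (m : M) (f : MvPolynomial σ R) :
    weightedHomogeneousComponent w (m + c) (D f) = D (weightedHomogeneousComponent w m f) := by
  classical
  induction f using MvPolynomial.induction_on' with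
  | add p q hp hq => simp [hp, hq]
  | monomial e r =>
    have he : IsWeightedHomogeneous w (monomial e r) _ := isWeightedHomogeneous_monomial w e r rfl
    rw [weightedHomogeneousComponent_of_mem (he.derivation D hD),
      weightedHomogeneousComponent_of_mem he]
    by_cases h : m = Finsupp.weight w e <;> simp [h]

theorem IsWeightedHomogeneous.of_X_mul [IsRightCancelAdd M] {w : σ → M} {m : M} {i : σ}
    {f : MvPolynomial σ R} (h : IsWeightedHomogeneous w (X i * f) (m + w i)) :
    IsWeightedHomogeneous w f m := by
  intro e he
  have := @h (Finsupp.single i 1 + e) (by rwa [coeff_X_mul])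
  rw [map_add, add_comm, Finsupp.weight_single, one_smul] at this
  exact add_right_cancel this

theorem IsWeightedHomogeneous.map_weight {N : Type*} [AddCommMonoid N] {w : σ → M} {m : M}
    {f : MvPolynomial σ R} (h : IsWeightedHomogeneous w f m) (g : M →+ N) :
    IsWeightedHomogeneous (g ∘ w) f (g m) := by
  intro e he
  rw [← h he, Finsupp.weight_apply, Finsupp.weight_apply, map_finsuppSum]
  simp

/-- Euler's identity with weights in the coefficient ring, so that negative weights are allowed:
monomials are eigenvectors of the derivation. -/
theorem mkDerivation_apply_of_smul {w : σ → R} {m : R} {f : MvPolynomial σ R}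
    (h : IsWeightedHomogeneous w f m) :
    mkDerivation R (fun i => w i • (X i : MvPolynomial σ R)) f = m • f := by
  induction h using IsWeightedHomogeneous.induction_on with
  | zero => simp
  | add p q _ _ hp hq => simp [hp, hq]
  | monomial e r he =>
    have key : ∀ i ∈ e.support, monomial (e - Finsupp.single i 1) (e i : R) •
        w i • (X i : MvPolynomial σ R) = (e i • w i) • monomial e 1 := by
      intro i hi
      have : 1 ≤ e i := Nat.one_le_iff_ne_zero.mpr (Finsupp.mem_support_iff.mp hi)
      rw [smul_eq_mul, X, smul_monomial, monomial_mul, smul_monomial,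
        tsub_add_cancel_of_le (Finsupp.single_le_iff.mpr this)]
      simp
    rw [mkDerivation_monomial, Finsupp.sum, Finset.sum_congr rfl key, ← Finset.sum_smul, ← he,
      Finsupp.weight_apply, Finsupp.sum, smul_comm, smul_monomial r]
    simp

end MvPolynomial

/-! ### The `sl₂`-action on the symbol letters -/

namespace Weitzenboeck

variable (K J : Type*) [Field K]

/-- The derivation `α_1 ↦ α_0`, `α_0 ↦ 0` in all symbol letters. -/
noncomputable def raising : Derivation K (MvPolynomial (J × Fin 2) K) (MvPolynomial (J × Fin 2) K) :=
  mkDerivation K fun v => if v.2 = 1 then X (v.1, 0) else 0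

/-- The derivation `α_0 ↦ α_1`, `α_1 ↦ 0` in all symbol letters. -/
noncomputable def lowering : Derivation K (MvPolynomial (J × Fin 2) K) (MvPolynomial (J × Fin 2) K) :=
  mkDerivation K fun v => if v.2 = 0 then X (v.1, 1) else 0

variable {K J}

@[simp] theorem raising_X_zero (α : J) : raising K J (X (α, 0)) = 0 := by simp [raising]
@[simp] theorem raising_X_one (α : J) : raising K J (X (α, 1)) = X (α, 0) := by simp [raising]
@[simp] theorem lowering_X_zero (α : J) : lowering K J (X (α, 0)) = X (α, 1) := by simp [lowering]
@[simp] theorem lowering_X_one (α : J) : lowering K J (X (α, 1)) = 0 := by simp [lowering]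

theorem raising_evalSymbol (P : SymbolicExpr K J) : raising K J (evalSymbol K J P) = 0 := by
  induction P using MvPolynomial.induction_on with
  | C a => simp [evalSymbol]
  | add p q hp hq => simp [hp, hq]
  | mul_X p v hp =>
    rcases v with v | v
    · simp [evalSymbol, Derivation.leibniz] at hp ⊢
      rw [hp]; ring
    · simp [evalSymbol, Derivation.leibniz] at hp ⊢
      rw [hp]

variable [DecidableEq J]

/-- The weight of `α_0` or `α_1` for the torus of `SL₂` together with the degree in every letter. -/
def torusWeight (v : J × Fin 2) : (J → ℕ) × ℤ := (Pi.single v.1 1, if v.2 = 0 then 1 else -1)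

/-- The weight of the evaluation of a bracket or of a `γ_0` for `torusWeight`. -/
def symbolTorusWeight (v : SymbolVar J) : (J → ℕ) × ℤ :=
  (symbolWeight v, Sum.elim (fun _ => 0) (fun _ => 1) v)

theorem isWeightedHomogeneous_X_of_eq {σ M : Type*} [AddCommMonoid M] {w : σ → M} {i : σ} {m : M}
    (h : w i = m) : IsWeightedHomogeneous w (X i : MvPolynomial σ K) m :=
  h ▸ isWeightedHomogeneous_X K w i

theorem isWeightedHomogeneous_raising_X (v : J × Fin 2) :
    IsWeightedHomogeneous torusWeight (raising K J (X v)) (torusWeight v + (0, 2)) := by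
  obtain ⟨α, i⟩ := v
  fin_cases i
  · simpa using isWeightedHomogeneous_zero K _ _
  · simpa using isWeightedHomogeneous_X_of_eq (by simp [torusWeight])

theorem isWeightedHomogeneous_lowering_X (v : J × Fin 2) :
    IsWeightedHomogeneous torusWeight (lowering K J (X v)) (torusWeight v + (0, -2)) := by
  obtain ⟨α, i⟩ := v
  fin_cases i
  · simpa using isWeightedHomogeneous_X_of_eq (by simp [torusWeight])
  · simpa using isWeightedHomogeneous_zero K _ _

theorem isWeightedHomogeneous_evalSymbol {P : SymbolicExpr K J} {m : (J → ℕ) × ℤ}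
    (hP : IsWeightedHomogeneous symbolTorusWeight P m) :
    IsWeightedHomogeneous torusWeight (evalSymbol K J P) m := by
  induction hP using IsWeightedHomogeneous.induction_on with
  | zero => simpa using isWeightedHomogeneous_zero K _ _
  | add p q _ _ hp hq => simpa using hp.add hq
  | monomial e r he =>
    rw [evalSymbol, aeval_monomial, algebraMap_eq]
    refine IsWeightedHomogeneous.C_mul ?_ _
    rw [← he, Finsupp.weight_apply]
    refine IsWeightedHomogeneous.prod _ _ _ fun v _ => IsWeightedHomogeneous.pow ?_ _
    rcases v with ⟨⟨α, β⟩, h⟩ | v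
    · have h1 := (isWeightedHomogeneous_X K (torusWeight (J := J)) (α, 0)).mul
        (isWeightedHomogeneous_X K (torusWeight (J := J)) (β, 1))
      have h2 := (isWeightedHomogeneous_X K (torusWeight (J := J)) (α, 1)).mul
        (isWeightedHomogeneous_X K (torusWeight (J := J)) (β, 0))
      have e1 : torusWeight (α, 0) + torusWeight (β, 1) =
        symbolTorusWeight (Sum.inl ⟨(α, β), h⟩) := by
        simp [torusWeight, symbolTorusWeight, symbolWeight]
      have e2 : torusWeight (α, 1) + torusWeight (β, 0) =
        symbolTorusWeight (Sum.inl ⟨(α, β), h⟩) := by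
        simp [torusWeight, symbolTorusWeight, symbolWeight]
      rw [e1] at h1
      rw [e2] at h2
      exact h1.sub h2
    · exact isWeightedHomogeneous_X_of_eq (by simp [torusWeight, symbolTorusWeight, symbolWeight])

/-- The commutator is a derivation with `α_0 ↦ α_0` and `α_1 ↦ -α_1`, hence the Euler operator of
the torus weight. -/
theorem raising_lowering {δ : J → ℕ} {w : ℤ} {f : MvPolynomial (J × Fin 2) K}
    (hf : IsWeightedHomogeneous torusWeight f (δ, w)) :
    raising K J (lowering K J f) = lowering K J (raising K J f) + (w : K) • f := by
  have h1 : ⁅raising K J, lowering K J⁆ = mkDerivation K fun v =>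
      (Int.castAddHom K).comp (AddMonoidHom.snd (J → ℕ) ℤ) (torusWeight v) •
        (X v : MvPolynomial (J × Fin 2) K) := by
    refine derivation_ext fun v => ?_
    obtain ⟨α, i⟩ := v
    fin_cases i <;> simp [Derivation.commutator_apply, torusWeight]
  have h2 := mkDerivation_apply_of_smul
    (hf.map_weight ((Int.castAddHom K).comp (AddMonoidHom.snd (J → ℕ) ℤ)))
  have h3 := congrArg (fun D => D f) h1
  simp only [Derivation.commutator_apply] at h3
  rw [sub_eq_iff_eq_add'] at h3
  rw [h3]
  congr 1

theorem isWeightedHomogeneous_iterate_lowering {δ : J → ℕ} {w : ℤ} {f : MvPolynomial (J × Fin 2) K}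
    (hf : IsWeightedHomogeneous torusWeight f (δ, w)) (n : ℕ) :
    IsWeightedHomogeneous torusWeight ((lowering K J)^[n] f) (δ, w - 2 * n) := by
  induction n with
  | zero => simpa using hf
  | succ n ih =>
    rw [Function.iterate_succ_apply']
    have := ih.derivation (lowering K J) isWeightedHomogeneous_lowering_X
    rwa [Prod.mk_add_mk, add_zero, sub_eq_add_neg, add_assoc,
      show -(2 * (n : ℤ)) + -2 = -(2 * ((n + 1 : ℕ) : ℤ)) by push_cast; ring,
      ← sub_eq_add_neg] at this

theorem raising_iterate_lowering {δ : J → ℕ} {w : ℤ} {f : MvPolynomial (J × Fin 2) K}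
    (hf : IsWeightedHomogeneous torusWeight f (δ, w)) (h0 : raising K J f = 0) (n : ℕ) :
    raising K J ((lowering K J)^[n + 1] f) =
      ((n + 1 : K) * (w - n)) • (lowering K J)^[n] f := by
  induction n with
  | zero => simp [raising_lowering hf, h0]
  | succ n ih =>
    rw [Function.iterate_succ_apply',
      raising_lowering (isWeightedHomogeneous_iterate_lowering hf (n + 1)), ih,
      Derivation.map_smul, ← Function.iterate_succ_apply' (lowering K J), ← add_smul]
    congr 1
    push_cast
    ring

theorem neg_sum_le_weight_torusWeight [Fintype J] (e : J × Fin 2 →₀ ℕ) :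
    -((∑ α, (Finsupp.weight torusWeight e).1 α : ℕ) : ℤ) ≤
      (Finsupp.weight (torusWeight (J := J)) e).2 := by
  induction e using Finsupp.induction_linear with
  | zero => simp
  | add f g hf hg =>
    simp only [map_add, Prod.fst_add, Prod.snd_add, Pi.add_apply, Finset.sum_add_distrib]
    push_cast at *
    linarith
  | single v n =>
    obtain ⟨α, i⟩ := v
    rw [Finsupp.weight_single]
    fin_cases i <;> simp [torusWeight, ← Finset.mul_sum]

/-- For `w < 0` the factors `(n + 1) * (w - n)` never vanish, so no power of `lowering` could kill a
nonzero `f`; but the weights in a fixed degree are bounded below. -/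
theorem eq_zero_of_raising_eq_zero [Fintype J] [CharZero K] {δ : J → ℕ} {w : ℤ}
    {f : MvPolynomial (J × Fin 2) K} (hf : IsWeightedHomogeneous torusWeight f (δ, w))
    (h0 : raising K J f = 0) (hw : w < 0) : f = 0 := by
  by_contra hne
  have hn : ∀ n : ℕ, (lowering K J)^[n] f ≠ 0 := by
    intro n
    induction n with
    | zero => simpa using hne
    | succ n ih =>
      intro h
      have := raising_iterate_lowering hf h0 n
      rw [h, map_zero, eq_comm, smul_eq_zero] at this
      refine this.elim (fun h => ?_) ih
      have h' : (((n + 1) * (w - n) : ℤ) : K) = 0 := by push_cast; exact h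
      rw [Int.cast_eq_zero] at h'
      rcases mul_eq_zero.mp h' with h' | h' <;> omega
  -- With `n` the total degree, the weight `w - 2 * n` falls below the least possible weight `-n`.
  set n := ∑ α, δ α
  obtain ⟨e, he⟩ := MvPolynomial.ne_zero_iff.mp (hn n)
  have h1 := isWeightedHomogeneous_iterate_lowering hf n he
  have h2 := neg_sum_le_weight_torusWeight e
  rw [h1] at h2
  change -((n : ℕ) : ℤ) ≤ w - 2 * n at h2
  omega

end Weitzenboeck

/-! ### First fundamental theorem for the unipotent group -/

namespace Weitzenboeck
variable {K J : Type*} [Field K] [DecidableEq J]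

variable (K) in
/-- The evaluations of symbolic expressions of a given weight. -/
noncomputable def evalSubmodule (m : (J → ℕ) × ℤ) : Submodule K (MvPolynomial (J × Fin 2) K) :=
  (weightedHomogeneousSubmodule K symbolTorusWeight m).map (evalSymbol K J).toLinearMap

theorem mem_evalSubmodule {m : (J → ℕ) × ℤ} {f : MvPolynomial (J × Fin 2) K} :
    f ∈ evalSubmodule K m ↔
      ∃ P, IsWeightedHomogeneous symbolTorusWeight P m ∧ evalSymbol K J P = f := by
  simp [evalSubmodule]

theorem X_mul_mem_evalSubmodule {m : (J → ℕ) × ℤ} {f : MvPolynomial (J × Fin 2) K} (α : J)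
    (hf : f ∈ evalSubmodule K m) :
    X (α, 0) * f ∈ evalSubmodule K ((Pi.single α 1, 1) + m) := by
  obtain ⟨P, hP, rfl⟩ := mem_evalSubmodule.mp hf
  exact mem_evalSubmodule.mpr ⟨X (Sum.inr α) * P,
    (isWeightedHomogeneous_X_of_eq (by simp [symbolTorusWeight, symbolWeight])).mul hP,
    by simp [evalSymbol]⟩

/-- Replacing a factor `γ_0` by the bracket `[γ, α]` realises the multiplication by `α_1`
modulo `α_0`. -/
theorem exists_mem_evalSubmodule_dvd_sub {δ : J → ℕ} {w : ℤ} {f : MvPolynomial (J × Fin 2) K}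
    (α : J) (hw : 0 < w) (hf : f ∈ evalSubmodule K (δ, w)) :
    ∃ g ∈ evalSubmodule K (δ + Pi.single α 1, w - 1), X (α, 0) ∣ X (α, 1) * f - g := by
  obtain ⟨P, hP, rfl⟩ := mem_evalSubmodule.mp hf
  clear hf
  induction hP using IsWeightedHomogeneous.induction_on with
  | zero => exact ⟨0, zero_mem _, by simp⟩
  | add p q _ _ hp hq =>
    obtain ⟨g, hg, hgp⟩ := hp
    obtain ⟨h, hh, hhq⟩ := hq
    refine ⟨g + h, add_mem hg hh, ?_⟩
    have := dvd_add hgp hhq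
    rw [map_add, mul_add]
    convert this using 1
    ring
  | monomial e r he =>
    -- Brackets have torus weight 0, so a positive weight forces a factor `γ_0`.
    obtain ⟨γ, hγ⟩ : ∃ γ, e (Sum.inr γ) ≠ 0 := by
      by_contra! h
      have h2 : (Finsupp.weight symbolTorusWeight e).2 = 0 := by
        rw [Finsupp.weight_apply, Finsupp.sum, Prod.snd_sum]
        refine Finset.sum_eq_zero fun v _ => ?_
        rcases v with v | v
        · simp [symbolTorusWeight]
        · simp [h v]
      rw [he] at h2
      exact hw.ne' h2
    have hsplit : monomial e r =
        X (Sum.inr γ) * (monomial (e - Finsupp.single (Sum.inr γ) 1) r : SymbolicExpr K J) := by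
      rw [X, monomial_mul, one_mul, add_tsub_cancel_of_le
        (Finsupp.single_le_iff.mpr (Nat.one_le_iff_ne_zero.mpr hγ))]
    have hev : evalSymbol K J (X (Sum.inr γ)) = X (γ, 0) := by simp [evalSymbol]
    by_cases hγα : γ = α
    · subst hγα
      refine ⟨0, zero_mem _, ?_⟩
      rw [hsplit, map_mul, hev, sub_zero]
      exact (dvd_mul_right _ _).mul_left _
    · have hbr : evalSymbol K J (X (Sum.inl ⟨(γ, α), hγα⟩)) =
          X (γ, 0) * X (α, 1) - X (γ, 1) * X (α, 0) := by simp [evalSymbol]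
      refine ⟨_, mem_evalSubmodule.mpr ⟨X (Sum.inl ⟨(γ, α), hγα⟩) *
        monomial (e - Finsupp.single (Sum.inr γ) 1) r, ?_, rfl⟩, ?_⟩
      · have h1 := (isWeightedHomogeneous_X K symbolTorusWeight
          (Sum.inl ⟨(γ, α), hγα⟩ : SymbolVar J)).mul (isWeightedHomogeneous_monomial
            symbolTorusWeight (e - Finsupp.single (Sum.inr γ) 1) r rfl)
        convert h1 using 1
        have h2 := Finsupp.weight_sub_single_add (w := symbolTorusWeight) hγ
        rw [he] at h2
        rw [← add_left_inj (symbolTorusWeight (Sum.inr γ)), add_assoc, h2]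
        ext
        · simp [symbolTorusWeight, symbolWeight]; ring
        · simp [symbolTorusWeight]
      · rw [hsplit, map_mul, map_mul, hev, hbr]
        exact Dvd.intro (X (γ, 1) * evalSymbol K J (monomial (e - Finsupp.single (Sum.inr γ) 1) r))
          (by ring)

theorem exists_mem_evalSubmodule_dvd_pow_sub {δ : J → ℕ} {w : ℤ} {f : MvPolynomial (J × Fin 2) K}
    (α : J) (k : ℕ) (hw : k ≤ w) (hf : f ∈ evalSubmodule K (δ, w)) :
    ∃ g ∈ evalSubmodule K (δ + Pi.single α k, w - k), X (α, 0) ∣ X (α, 1) ^ k * f - g := by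
  induction k with
  | zero => exact ⟨f, by simpa using hf, by simp⟩
  | succ k ih =>
    obtain ⟨g, hg, hgf⟩ := ih (by push_cast at hw; linarith)
    obtain ⟨h, hh, hhg⟩ := exists_mem_evalSubmodule_dvd_sub α (by push_cast at hw; linarith) hg
    refine ⟨h, ?_, ?_⟩
    · rw [add_assoc, ← Pi.single_add] at hh
      rw [show w - (k + 1 : ℕ) = w - k - 1 by push_cast; ring]
      exact hh
    · have := dvd_add (hgf.mul_left (X (α, 1))) hhg
      convert this using 1
      ring

/-- The substitution `α_0 ↦ 0`, `α_1 ↦ 1`. -/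
noncomputable def dehomogenize (K : Type*) [Field K] (α : J) :
    MvPolynomial (J × Fin 2) K →ₐ[K] MvPolynomial (J × Fin 2) K :=
  aeval fun v => if v.1 = α then (if v.2 = 0 then 0 else 1) else X v

/-- The substitution is compatible because `α_1 ↦ α_0` becomes `1 ↦ 0`. -/
theorem raising_dehomogenize (α : J) (f : MvPolynomial (J × Fin 2) K) :
    raising K J (dehomogenize K α f) = dehomogenize K α (raising K J f) := by
  induction f using MvPolynomial.induction_on with
  | C a => simp [dehomogenize]
  | add p q hp hq => simp [hp, hq]
  | mul_X p v hp =>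
    have hX : raising K J (dehomogenize K α (X v)) = dehomogenize K α (raising K J (X v)) := by
      obtain ⟨β, i⟩ := v
      by_cases h : β = α <;> fin_cases i <;> simp [dehomogenize, h]
    rw [map_mul, Derivation.leibniz, Derivation.leibniz, hp, hX]
    simp

/-- A monomial containing `α_0` dies under the substitution and is divisible by `α_0`; any other
contains `α` exactly as `α_1 ^ δ α`, whose removal raises the torus weight by `δ α`. -/
theorem dehomogenize_spec {δ : J → ℕ} {w : ℤ} {f : MvPolynomial (J × Fin 2) K} (α : J)
    (hf : IsWeightedHomogeneous torusWeight f (δ, w)) :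
    IsWeightedHomogeneous torusWeight (dehomogenize K α f) (Function.update δ α 0, w + δ α) ∧
      X (α, 0) ∣ f - X (α, 1) ^ δ α * dehomogenize K α f := by
  induction hf using IsWeightedHomogeneous.induction_on with
  | zero => simpa using isWeightedHomogeneous_zero K _ _
  | add p q _ _ hp hq =>
    refine ⟨by simpa using hp.1.add hq.1, ?_⟩
    have := dvd_add hp.2 hq.2
    rw [map_add]
    convert this using 1
    ring
  | monomial e r he =>
    by_cases h0 : e (α, 0) = 0
    · set e' := e.erase (α, 1) with he'
      have hsplit : Finsupp.single (α, 1) (e (α, 1)) + e' = e := Finsupp.single_add_erase _ _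
      have hwt : e (α, 1) • torusWeight (α, 1) + Finsupp.weight torusWeight e' = (δ, w) := by
        rw [← he, ← Finsupp.weight_single, ← map_add, hsplit]
      have hα : (Finsupp.weight torusWeight e').1 α = 0 := by
        rw [Finsupp.weight_apply, Finsupp.sum, Prod.fst_sum, Finset.sum_apply]
        refine Finset.sum_eq_zero fun v hv => ?_
        by_cases hvα : v.1 = α
        · obtain ⟨β, i⟩ := v
          obtain rfl : β = α := hvα
          exfalso
          fin_cases i
          · simp [he', h0] at hv
          · simp [he'] at hv
        · simp [torusWeight, Ne.symm hvα]
      have hδ : e (α, 1) = δ α := by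
        have := congrFun (congrArg Prod.fst hwt) α
        simpa [torusWeight, hα] using this
      have hmon : monomial e r = X (α, 1) ^ δ α * monomial e' r := by
        rw [← hδ, X_pow_eq_monomial, monomial_mul, hsplit, one_mul]
      have hde' : dehomogenize K α (monomial e' r) = monomial e' r := by
        rw [dehomogenize, aeval_monomial, monomial_eq, algebraMap_eq]
        congr 1
        refine Finset.prod_congr rfl fun v hv => ?_
        dsimp only
        rw [if_neg]
        rintro hvα
        obtain ⟨β, i⟩ := v
        obtain rfl : β = α := hvα
        fin_cases i
        · simp [he', h0] at hv
        · simp [he'] at hv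
      have hX : dehomogenize K α (X (α, 1)) = 1 := by simp [dehomogenize]
      rw [hmon, map_mul, map_pow, hX, one_pow, one_mul, hde', sub_self]
      refine ⟨isWeightedHomogeneous_monomial _ _ _ ?_, dvd_zero _⟩
      ext β
      · rcases eq_or_ne β α with rfl | hβ
        · simp [hα]
        · have := congrFun (congrArg Prod.fst hwt) β
          simpa [torusWeight, hβ] using this
      · have := congrArg Prod.snd hwt
        simp [torusWeight, hδ] at this ⊢
        linarith
    · have hz : dehomogenize K α (monomial e r) = 0 := by
        rw [dehomogenize, aeval_monomial, Finsupp.prod, Finset.prod_eq_zero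
          (Finsupp.mem_support_iff.mpr h0), mul_zero]
        simp [h0]
      rw [hz, mul_zero, sub_zero]
      exact ⟨isWeightedHomogeneous_zero K _ _, X_dvd_monomial.mpr (Or.inr h0)⟩

/-- First fundamental theorem for the unipotent subgroup of `SL₂` acting on vectors: the constants
of the derivation `α_1 ↦ α_0 ↦ 0` are the polynomials in the `α_0` and the brackets. -/
theorem mem_evalSubmodule_of_raising_eq_zero [Fintype J] [CharZero K] {δ : J → ℕ} {w : ℤ}
    {f : MvPolynomial (J × Fin 2) K} (hf : IsWeightedHomogeneous torusWeight f (δ, w))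
    (h0 : raising K J f = 0) : f ∈ evalSubmodule K (δ, w) := by
  induction hN : ∑ α, δ α using Nat.strong_induction_on generalizing δ w f with
  | _ N ih =>
  rcases lt_or_ge w 0 with hw | hw
  · rw [eq_zero_of_raising_eq_zero hf h0 hw]
    exact zero_mem _
  by_cases hδ : δ = 0
  · have hC : f = C (coeff 0 f) := by
      ext e
      rw [coeff_C]
      split_ifs with h
      · rw [h]
      · by_contra hne
        refine h (Finsupp.ext fun v => ?_)
        have := congrFun (congrArg Prod.fst (hf hne)) v.1
        rw [Finsupp.weight_eq_sum, Prod.fst_sum, Finset.sum_apply, hδ,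
          show ((0 : J → ℕ), w).1 v.1 = 0 from rfl, Finset.sum_eq_zero_iff] at this
        simpa [torusWeight] using (this v (Finset.mem_univ v)).symm
    by_cases hc : coeff 0 f = 0
    · rw [hC, hc, C_0]
      exact zero_mem _
    · have := hf hc
      rw [map_zero] at this
      rw [← this, mem_evalSubmodule]
      exact ⟨C (coeff 0 f), isWeightedHomogeneous_C _ _, by
        conv_rhs => rw [hC]
        simp [evalSymbol]⟩
  obtain ⟨α, hα⟩ := Function.ne_iff.mp hδ
  have hα : δ α ≠ 0 := hα
  obtain ⟨hg, hdvd⟩ := dehomogenize_spec α hf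
  have hlt : ∑ β, Function.update δ α 0 β < N := by
    rw [← hN]
    refine Finset.sum_lt_sum (fun β _ => ?_) ⟨α, Finset.mem_univ α, by simp; omega⟩
    by_cases h : β = α <;> simp [h]
  have hgT := ih _ hlt hg (by rw [raising_dehomogenize, h0, map_zero]) rfl
  -- Here `0 ≤ w` is essential: it leaves at least `δ α` factors `γ_0` to convert.
  obtain ⟨h, hh, hhg⟩ := exists_mem_evalSubmodule_dvd_pow_sub α (δ α) (by linarith) hgT
  have hupd : Function.update δ α 0 + Pi.single α (δ α) = δ := by
    ext β
    by_cases h : β = α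
    · subst h; simp
    · simp [h]
  rw [hupd, add_sub_cancel_right] at hh
  obtain ⟨f', hf'⟩ : X (α, 0) ∣ f - h := by
    have := dvd_add hdvd hhg
    rwa [sub_add_sub_cancel] at this
  obtain ⟨P, hP, rfl⟩ := mem_evalSubmodule.mp hh
  have hm : (δ, w) = (δ - Pi.single α 1, w - 1) + torusWeight (α, 0) := by
    ext β
    · by_cases h : β = α
      · subst h
        simp [torusWeight]
        omega
      · simp [torusWeight, h]
    · simp [torusWeight]
  -- The weight `w - 1` may be negative; the induction hypothesis covers this.
  have hf'w : IsWeightedHomogeneous torusWeight f' (δ - Pi.single α 1, w - 1) := by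
    refine IsWeightedHomogeneous.of_X_mul (i := (α, 0)) ?_
    rw [← hf', ← hm]
    exact hf.sub (isWeightedHomogeneous_evalSymbol hP)
  have hf'0 : raising K J f' = 0 := by
    have := congrArg (raising K J) hf'
    rw [map_sub, h0, raising_evalSymbol, Derivation.leibniz, raising_X_zero] at this
    simpa using this.symm
  have hlt' : ∑ β, (δ - Pi.single α 1 : J → ℕ) β < N := by
    rw [← hN]
    refine Finset.sum_lt_sum (fun β _ => by simp) ⟨α, Finset.mem_univ α, by simp; omega⟩
  have := X_mul_mem_evalSubmodule α (ih _ hlt' hf'w hf'0 rfl)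
  rw [← hf', add_comm, show ((Pi.single α 1 : J → ℕ), (1 : ℤ)) = torusWeight (α, 0) by
    simp [torusWeight], ← hm] at this
  simpa using add_mem this hh

end Weitzenboeck

/-! ### Symbolic monomials as convolutions -/

namespace Weitzenboeck
variable {K J : Type*} [Field K]

theorem conv_monomial {α β : J} (h : α ≠ β) (E : SymbolVar J →₀ ℕ) (r : K) :
    conv α β h (monomial E r) =
      monomial (Finsupp.single (Sum.inl ⟨(α, β), h⟩) 1 +
        (E - Finsupp.single (Sum.inr β) 1 - Finsupp.single (Sum.inr α) 1))
        (r * E (Sum.inr β) * E (Sum.inr α)) := by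
  rw [conv, pderiv_monomial, pderiv_monomial, X, monomial_mul, one_mul]
  simp [h.symm]

variable [DecidableEq J]

/-- Removes the torus weight from the fundamental theorem: `raising` is homogeneous, so it kills
each torus component of `f` separately. -/
theorem exists_evalSymbol_eq_of_raising_eq_zero [Fintype J] [CharZero K] {δ : J → ℕ}
    {f : MvPolynomial (J × Fin 2) K}
    (hf : IsWeightedHomogeneous (fun v : J × Fin 2 => (Pi.single v.1 1 : J → ℕ)) f δ)
    (h0 : raising K J f = 0) :
    ∃ P, IsWeightedHomogeneous symbolWeight P δ ∧ evalSymbol K J P = f := by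
  suffices h : f ∈ (weightedHomogeneousSubmodule K (symbolWeight (J := J)) δ).map
      (evalSymbol K J).toLinearMap by simpa using h
  rw [← sum_weightedHomogeneousComponent torusWeight f,
    finsum_eq_sum _ (weightedHomogeneousComponent_finsupp f)]
  refine Submodule.sum_mem _ fun m _ => ?_
  obtain ⟨δ', w⟩ := m
  set g := weightedHomogeneousComponent torusWeight (δ', w) f with hg
  have hgw : IsWeightedHomogeneous torusWeight g (δ', w) :=
    weightedHomogeneousComponent_isWeightedHomogeneous _ _
  by_cases hgne : g = 0
  · rw [hgne]
    exact zero_mem _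
  have hg0 : raising K J g = 0 := by
    rw [hg, ← weightedHomogeneousComponent_derivation _ isWeightedHomogeneous_raising_X, h0,
      map_zero]
  obtain rfl : δ' = δ := by
    obtain ⟨e, he⟩ := MvPolynomial.ne_zero_iff.mp hgne
    have h1 : (Finsupp.weight torusWeight e).1 = δ' := congrArg Prod.fst (hgw he)
    rw [hg, coeff_weightedHomogeneousComponent] at he
    have h2 := hf (ite_ne_right_iff.mp he).2
    rw [← h1, ← h2, Finsupp.weight_apply, Finsupp.weight_apply, Finsupp.sum, Finsupp.sum,
      Prod.fst_sum]
    rfl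
  obtain ⟨P, hP, hPg⟩ := mem_evalSubmodule.mp (mem_evalSubmodule_of_raising_eq_zero hgw hg0)
  exact ⟨P, hP.map_weight (AddMonoidHom.fst (J → ℕ) ℤ), hPg⟩

theorem leadingSymbol_eq_monomial [Fintype J] {s : ℕ} (d : Fin s → ℕ) (φ : J → Fin s)
    {E : SymbolVar J →₀ ℕ} (hE : Finsupp.weight symbolWeight E = d ∘ φ)
    (h0 : ∀ p, E (Sum.inl p) = 0) : leadingSymbol K d φ = monomial E 1 := by
  have h1 : ∀ α, E (Sum.inr α) = d (φ α) := by
    intro α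
    have h := congrFun hE α
    rw [Finsupp.weight_eq_sum, Fintype.sum_sum_type] at h
    simpa [h0, symbolWeight, Pi.single_apply] using h
  rw [monomial_eq, C_1, one_mul, Finsupp.prod_fintype _ _ (by simp), Fintype.prod_sum_type]
  simp [h0, h1, leadingSymbol]

theorem exists_isConvolution_monomial [Fintype J] [CharZero K] {s : ℕ} (d : Fin s → ℕ)
    (φ : J → Fin s) (E : SymbolVar J →₀ ℕ) (hE : Finsupp.weight symbolWeight E = d ∘ φ) :
    ∃ c : K, c ≠ 0 ∧ IsConvolution (leadingSymbol K d φ) (monomial E c) := by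
  induction hN : ∑ p, E (Sum.inl p) generalizing E with
  | zero =>
    refine ⟨1, one_ne_zero, ?_⟩
    rw [leadingSymbol_eq_monomial d φ hE
      (fun p => Finset.sum_eq_zero_iff.mp hN p (Finset.mem_univ p))]
    exact Relation.ReflTransGen.refl
  | succ N ih =>
    obtain ⟨p, -, hp⟩ := Finset.exists_ne_zero_of_sum_ne_zero (hN.trans_ne N.succ_ne_zero)
    obtain ⟨⟨α, β⟩, h⟩ := p
    obtain ⟨E', rfl⟩ := exists_add_of_le (Finsupp.single_le_iff.mpr (Nat.one_le_iff_ne_zero.mpr hp))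
    -- One bracket `[α, β]` is undone to `α_0 β_0`. Convolving restores it, with the two exponents
    -- as factors; these are positive, hence nonzero in characteristic 0.
    obtain ⟨c, hc, hconv⟩ := ih (Finsupp.single (Sum.inr β) 1 + (Finsupp.single (Sum.inr α) 1 + E'))
      (by
        rw [← hE]
        simp only [map_add, Finsupp.weight_single, one_smul, symbolWeight]
        abel)
      (by
        simp only [Finsupp.add_apply, Finset.sum_add_distrib, Finsupp.single_apply,
          Sum.inl.injEq, reduceCtorEq, if_false, Finset.sum_ite_eq, Finset.mem_univ,
          if_true] at hN ⊢
        simp at hN ⊢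
        omega)
    have hstep := hconv.tail ⟨α, β, h, rfl⟩
    rw [conv_monomial, add_tsub_cancel_left, add_tsub_cancel_left] at hstep
    refine ⟨_, ?_, hstep⟩
    have e1 : ∀ n : ℕ, (1 + n : K) ≠ 0 := fun n => by
      rw [add_comm]; exact Nat.cast_add_one_ne_zero n
    simp [hc, h, h.symm, e1]

theorem mem_span_isConvolution [Fintype J] [CharZero K] {s : ℕ} (d : Fin s → ℕ)
    (φ : J → Fin s) {P : SymbolicExpr K J} (hP : IsWeightedHomogeneous symbolWeight P (d ∘ φ)) :
    P ∈ Submodule.span K {Q | IsConvolution (leadingSymbol K d φ) Q} := by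
  induction hP using IsWeightedHomogeneous.induction_on with
  | zero => exact zero_mem _
  | add p q _ _ hp hq => exact add_mem hp hq
  | monomial E r hE =>
    obtain ⟨c, hc, hconv⟩ := exists_isConvolution_monomial (K := K) d φ E hE
    have : monomial E r = (r / c) • monomial E c := by
      rw [smul_monomial, smul_eq_mul, div_mul_cancel₀ _ hc]
    rw [this]
    exact Submodule.smul_mem _ _ (Submodule.subset_span hconv)

theorem IsConvolution.isWeightedHomogeneous {P Q : SymbolicExpr K J} {δ : J → ℕ}
    (hP : IsWeightedHomogeneous symbolWeight P δ) (h : IsConvolution P Q) :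
    IsWeightedHomogeneous symbolWeight Q δ := by
  induction h with
  | refl => exact hP
  | tail hA hAB ih =>
    obtain ⟨α, β, h, rfl⟩ := hAB
    clear hP hA
    induction ih using IsWeightedHomogeneous.induction_on with
    | zero => simpa [conv] using isWeightedHomogeneous_zero K _ _
    | add p q _ _ hp hq => simpa [conv, mul_add] using hp.add hq
    | monomial E r hE =>
      rw [conv_monomial]
      by_cases hβ : E (Sum.inr β) = 0
      · simpa [hβ] using isWeightedHomogeneous_zero K _ _
      by_cases hα : E (Sum.inr α) = 0
      · simpa [hα] using isWeightedHomogeneous_zero K _ _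
      refine isWeightedHomogeneous_monomial _ _ _ ?_
      rw [← hE, ← Finsupp.weight_sub_single_add (w := symbolWeight) hβ,
        ← Finsupp.weight_sub_single_add (w := symbolWeight) (i := Sum.inr α)
          (f := E - Finsupp.single (Sum.inr β) 1) (by simpa [h.symm] using hα),
        map_add, Finsupp.weight_single, one_smul]
      simp only [symbolWeight]
      abel

end Weitzenboeck

/-! ### Polarization -/

namespace MvPolynomial
variable {R M σ : Type*} [CommSemiring R] [AddCommMonoid M]

theorem pderiv_weightedHomogeneousComponent [IsRightCancelAdd M] (w : σ → M) (m : M) (i : σ)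
    (f : MvPolynomial σ R) :
    pderiv i (weightedHomogeneousComponent w (m + w i) f) =
      weightedHomogeneousComponent w m (pderiv i f) := by
  classical
  ext e
  rw [coeff_pderiv, coeff_weightedHomogeneousComponent, coeff_weightedHomogeneousComponent,
    coeff_pderiv, map_add, Finsupp.weight_single, one_smul]
  simp only [add_left_inj, ite_mul, zero_mul]

end MvPolynomial

namespace Weitzenboeck
variable {K J : Type*} [Field K] {s : ℕ} {d : Fin s → ℕ}

@[simp] theorem derivation_X_zero (i : Fin s) : derivation K d (X ⟨i, 0⟩) = 0 := by
  simp [derivation]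

@[simp] theorem derivation_X_succ (i : Fin s) (j : Fin (d i)) :
    derivation K d (X ⟨i, j.succ⟩) = X ⟨i, j.castSucc⟩ := by
  simp [derivation]

/-- The commutator of the two derivations is again a derivation, so comparison on the variables
suffices. -/
theorem pderiv_castSucc_derivation (i : Fin s) (j : Fin (d i)) (F : MvPolynomial (Var d) K) :
    pderiv ⟨i, j.castSucc⟩ (derivation K d F) =
      derivation K d (pderiv ⟨i, j.castSucc⟩ F) + pderiv ⟨i, j.succ⟩ F := by
  have h : ⁅pderiv (R := K) (⟨i, j.castSucc⟩ : Var d), derivation K d⁆ =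
      pderiv (R := K) (⟨i, j.succ⟩ : Var d) := by
    refine derivation_ext fun v => ?_
    obtain ⟨i', k⟩ := v
    rw [Derivation.commutator_apply, pderiv_X]
    have h0 : derivation K d (Pi.single (M := fun _ => MvPolynomial (Var d) K)
        (⟨i, j.castSucc⟩ : Var d) 1 ⟨i', k⟩) = 0 := by
      rw [Pi.single_apply]; split_ifs <;> simp
    rw [h0, sub_zero]
    refine Fin.cases ?_ (fun k => ?_) k
    · rw [derivation_X_zero, map_zero, pderiv_X_of_ne]
      rintro h
      obtain rfl : i' = i := congrArg Sigma.fst h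
      simp at h
      exact absurd h.symm (Fin.succ_ne_zero j)
    · rw [derivation_X_succ, pderiv_X, pderiv_X, Pi.single_apply, Pi.single_apply]
      refine if_congr ?_ rfl rfl
      constructor
      · intro h
        obtain rfl : i' = i := congrArg Sigma.fst h
        simpa using h
      · intro h
        obtain rfl : i' = i := congrArg Sigma.fst h
        simpa using h
  rw [← h, Derivation.commutator_apply]
  ring

theorem pderiv_last_derivation (i : Fin s) (F : MvPolynomial (Var d) K) :
    pderiv ⟨i, Fin.last (d i)⟩ (derivation K d F) =
      derivation K d (pderiv ⟨i, Fin.last (d i)⟩ F) := by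
  have h : ⁅pderiv (R := K) (⟨i, Fin.last (d i)⟩ : Var d), derivation K d⁆ = 0 := by
    refine derivation_ext fun v => ?_
    obtain ⟨i', k⟩ := v
    rw [Derivation.commutator_apply, pderiv_X]
    have h0 : derivation K d (Pi.single (M := fun _ => MvPolynomial (Var d) K)
        (⟨i, Fin.last (d i)⟩ : Var d) 1 ⟨i', k⟩) = 0 := by
      rw [Pi.single_apply]; split_ifs <;> simp
    rw [h0, sub_zero]
    refine Fin.cases (by simp) (fun k => ?_) k
    rw [derivation_X_succ, pderiv_X_of_ne]
    · rfl
    · intro h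
      obtain rfl : i' = i := congrArg Sigma.fst h
      simp at h
  rw [← sub_eq_zero, ← Derivation.commutator_apply, h, Derivation.zero_apply]

/-- The exponent of `α_0 ^ (d x - i) * α_1 ^ i` for the letter `x` of `α`. -/
noncomputable def symbolExponent (d : Fin s → ℕ) (φ : J → Fin s) (α : J)
    (i : Fin (d (φ α) + 1)) : J × Fin 2 →₀ ℕ :=
  Finsupp.single (α, 0) (d (φ α) - i) + Finsupp.single (α, 1) (i : ℕ)

/-- The (unnormalised) polarization of a polynomial with respect to a list of symbol letters. -/
noncomputable def polarize (K : Type*) [Field K] (d : Fin s → ℕ) (φ : J → Fin s) :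
    List J → MvPolynomial (Var d) K →ₗ[K] MvPolynomial (J × Fin 2) K
  | [] => Algebra.linearMap K _ ∘ₗ lcoeff K 0
  | α :: l => ∑ i : Fin (d (φ α) + 1),
      LinearMap.mulLeft K (monomial (symbolExponent d φ α i) ((i : ℕ).factorial : K)⁻¹) ∘ₗ
        polarize K d φ l ∘ₗ (pderiv (⟨φ α, i⟩ : Var d)).toLinearMap

theorem polarize_nil (φ : J → Fin s) (F : MvPolynomial (Var d) K) :
    polarize K d φ [] F = C (coeff 0 F) := rfl

theorem polarize_cons (φ : J → Fin s) (α : J) (l : List J) (F : MvPolynomial (Var d) K) :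
    polarize K d φ (α :: l) F = ∑ i : Fin (d (φ α) + 1),
      monomial (symbolExponent d φ α i) ((i : ℕ).factorial : K)⁻¹ *
        polarize K d φ l (pderiv ⟨φ α, i⟩ F) := by
  simp [polarize]

theorem monomial_symbolExponent (φ : J → Fin s) (α : J) (i : Fin (d (φ α) + 1)) (r : K) :
    monomial (symbolExponent d φ α i) r =
      C r * (X (α, 0) ^ (d (φ α) - i) * X (α, 1) ^ (i : ℕ)) := by
  rw [symbolExponent, X_pow_eq_monomial, X_pow_eq_monomial, monomial_mul, C_mul_monomial, one_mul,
    mul_one]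

theorem raising_monomial_symbolExponent_zero (φ : J → Fin s) (α : J) (r : K) :
    raising K J (monomial (symbolExponent d φ α 0) r) = 0 := by
  rw [monomial_symbolExponent]
  simp [Derivation.leibniz, Derivation.leibniz_pow]

theorem raising_monomial_symbolExponent_succ [CharZero K] (φ : J → Fin s) (α : J)
    (j : Fin (d (φ α))) :
    raising K J (monomial (symbolExponent d φ α j.succ) ((j.succ : ℕ).factorial : K)⁻¹) =
      monomial (symbolExponent d φ α j.castSucc) ((j.castSucc : ℕ).factorial : K)⁻¹ := by
  rw [monomial_symbolExponent, monomial_symbolExponent]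
  have h1 : d (φ α) - (j : ℕ) = d (φ α) - (j + 1) + 1 := by omega
  have h2 : C ((((j : ℕ) + 1).factorial : K)⁻¹) * ((j : ℕ) + 1 : MvPolynomial (J × Fin 2) K) =
      C (((j : ℕ).factorial : K)⁻¹) := by
    have : ((j : ℕ) + 1 : MvPolynomial (J × Fin 2) K) = C ((j : ℕ) + 1 : K) := by simp
    rw [this, ← C_mul, Nat.factorial_succ]
    congr 1
    have := Nat.cast_add_one_ne_zero (R := K) (j : ℕ)
    push_cast
    field_simp
  simp only [Fin.val_succ, Fin.val_castSucc, Derivation.leibniz, Derivation.leibniz_pow,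
    derivation_C, raising_X_zero, raising_X_one, smul_eq_mul, nsmul_eq_mul, mul_zero, add_zero,
    h1, Nat.add_sub_cancel, Nat.cast_add, Nat.cast_one]
  rw [← h2]
  ring

/-- Raising shifts the divided monomials `α_0 ^ (d - i) * α_1 ^ i / i!` from `i` to `i - 1`, while
commuting `∂/∂x_i` past the Weitzenböck derivation produces `∂/∂x_{i+1}`. The two shifts match after
reindexing. -/
theorem raising_polarize [CharZero K] (φ : J → Fin s) (l : List J) (F : MvPolynomial (Var d) K) :
    raising K J (polarize K d φ l F) = polarize K d φ l (derivation K d F) := by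
  induction l generalizing F with
  | nil =>
    have h : coeff 0 (derivation K d F) = 0 := by
      induction F using MvPolynomial.induction_on with
      | C a => simp
      | add p q hp hq => simp [hp, hq]
      | mul_X p v hp =>
        obtain ⟨i, k⟩ := v
        rw [Derivation.leibniz, smul_eq_mul, smul_eq_mul, coeff_add]
        refine Fin.cases ?_ (fun k => ?_) k <;> simp [coeff_X_mul', coeff_mul_X']
    simp [polarize_nil, h]
  | cons α l ih =>
    rw [polarize_cons, polarize_cons, map_sum]
    simp only [Derivation.leibniz, smul_eq_mul, ih, Finset.sum_add_distrib]
    rw [Fin.sum_univ_castSucc, Fin.sum_univ_succ (fun i : Fin (d (φ α) + 1) =>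
      polarize K d φ l (pderiv ⟨φ α, i⟩ F) * _), Fin.sum_univ_castSucc (n := d (φ α))]
    simp only [pderiv_castSucc_derivation, pderiv_last_derivation, map_add, mul_add,
      Finset.sum_add_distrib, raising_monomial_symbolExponent_succ,
      raising_monomial_symbolExponent_zero]
    simp only [mul_comm (polarize K d φ l _)]
    ring

theorem lambdaMap_monomial [Fintype J] (φ : J → Fin s) (e : J × Fin 2 →₀ ℕ) (r : K) :
    lambdaMap d φ (monomial e r) =
      r • ∏ α, ((e (α, 1)).factorial : K) • letterVar K d (φ α) (e (α, 1)) := by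
  have h : (monomial e r : MvPolynomial (J × Fin 2) K) = r • basisMonomials (J × Fin 2) K e := by
    simp [smul_monomial]
  rw [h, map_smul, lambdaMap, Module.Basis.constr_basis]

variable [DecidableEq J]

theorem isWeightedHomogeneous_polarize (φ : J → Fin s) (l : List J) (F : MvPolynomial (Var d) K) :
    IsWeightedHomogeneous (fun v : J × Fin 2 => (Pi.single v.1 1 : J → ℕ)) (polarize K d φ l F)
      (l.map fun α => Pi.single α (d (φ α))).sum := by
  induction l generalizing F with
  | nil => exact isWeightedHomogeneous_C _ _
  | cons α l ih =>
    rw [polarize_cons, List.map_cons, List.sum_cons]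
    refine IsWeightedHomogeneous.sum _ _ _ fun i _ => IsWeightedHomogeneous.mul ?_ (ih _)
    refine isWeightedHomogeneous_monomial _ _ _ ?_
    have : (i : ℕ) ≤ d (φ α) := Nat.lt_succ_iff.mp i.2
    rw [symbolExponent, map_add, Finsupp.weight_single, Finsupp.weight_single, ← add_smul,
      Nat.sub_add_cancel this]
    ext β
    simp [Pi.single_apply]

theorem sum_X_mul_pderiv_multidegree {c : Fin s → ℕ} {F : MvPolynomial (Var d) K}
    (hF : IsWeightedHomogeneous (multidegree d) F c) (x : Fin s) :
    ∑ i : Fin (d x + 1), X ⟨x, i⟩ * pderiv ⟨x, i⟩ F = c x • F := by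
  have h := (hF.map_weight (Pi.evalAddMonoidHom (fun _ : Fin s => ℕ) x)).sum_weight_X_mul_pderiv
  rw [Fintype.sum_sigma, Finset.sum_eq_single x] at h
  · simpa [multidegree] using h
  · intro y _ hy
    simp [multidegree, hy.symm]
  · simp

/-- The monomial `e` stores the choices made for letters already processed, which is what the
induction on `l` needs. Each letter contributes `∑ x_i ∂/∂x_i`, the `i!` of Λ cancelling the `1 /
i!` of `polarize`; Euler's identity then yields the factorials one factor at a time. -/
theorem lambdaMap_monomial_mul_polarize [Fintype J] [CharZero K] (φ : J → Fin s) (l : List J)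
    (hl : l.Nodup) (F : MvPolynomial (Var d) K) (e : J × Fin 2 →₀ ℕ) (r : K)
    (he : ∀ α ∈ l, e (α, 1) = 0) :
    lambdaMap d φ (monomial e r * polarize K d φ l F) =
      (r * ∏ i, ((l.map φ).count i).factorial) •
        ((∏ α with α ∉ l, ((e (α, 1)).factorial : K) • letterVar K d (φ α) (e (α, 1))) *
          weightedHomogeneousComponent (multidegree d) (fun i => (l.map φ).count i) F) := by
  induction l generalizing F e r with
  | nil =>
    have h : weightedHomogeneousComponent (multidegree d) 0 F = C (coeff 0 F) :=
      weightedHomogeneousComponent_zero _ fun v => by simp [multidegree]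
    have h0 : (fun i => (([] : List J).map φ).count i) = (0 : Fin s → ℕ) := by ext; simp
    rw [h0, h, polarize_nil, mul_comm, C_mul_monomial, lambdaMap_monomial, mul_comm _ (C _),
      ← smul_eq_C_mul, smul_smul]
    simp [mul_comm]
  | cons α l ih =>
    obtain ⟨hαl, hl⟩ := List.nodup_cons.mp hl
    set c : Fin s → ℕ := fun i => (l.map φ).count i with hc
    have hc' : (fun i => ((α :: l).map φ).count i) = c + Pi.single (φ α) 1 := by
      ext i
      by_cases h : φ α = i
      · subst h; simp [hc]
      · simp [hc, h, Ne.symm h]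
    have hfact : ∏ i, (((α :: l).map φ).count i).factorial =
        (c (φ α) + 1) * ∏ i, (c i).factorial := by
      have h1 : ∀ i, (((α :: l).map φ).count i).factorial =
          (if i = φ α then c (φ α) + 1 else 1) * (c i).factorial := by
        intro i
        rw [congrFun hc' i]
        by_cases h : i = φ α
        · subst h; simp [Nat.factorial_succ]
        · simp [h]
      rw [Finset.prod_congr rfl fun i _ => h1 i, Finset.prod_mul_distrib]
      simp
    -- The letter `α` is outside the tail `l`, so its variable appears in the product there and
    -- supplies the `x_i` in front of `∂/∂x_i`.
    have hset : (Finset.univ.filter fun β => β ∉ l) =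
        insert α (Finset.univ.filter fun β => β ∉ α :: l) := by
      ext β
      by_cases h : β = α
      · subst h; simp [hαl]
      · simp [h]
    have hterm : ∀ i : Fin (d (φ α) + 1),
        lambdaMap d φ (monomial e r * (monomial (symbolExponent d φ α i) ((i : ℕ).factorial : K)⁻¹ *
          polarize K d φ l (pderiv ⟨φ α, i⟩ F))) =
        (r * ∏ i, (c i).factorial) •
          ((∏ β with β ∉ α :: l, ((e (β, 1)).factorial : K) • letterVar K d (φ β) (e (β, 1))) *
          (X ⟨φ α, i⟩ * pderiv ⟨φ α, i⟩
            (weightedHomogeneousComponent (multidegree d) (c + Pi.single (φ α) 1) F))) := by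
      intro i
      have hα : (e + symbolExponent d φ α i) (α, 1) = i := by
        simp [symbolExponent, he α]
      have hβ : ∀ β, β ≠ α → (e + symbolExponent d φ α i) (β, 1) = e (β, 1) := by
        intro β hβ
        simp [symbolExponent, hβ.symm]
      rw [← mul_assoc, monomial_mul, ih hl _ _ _ fun β hβl => by
        rw [hβ β (by rintro rfl; exact hαl hβl), he β (List.mem_cons_of_mem _ hβl)]]
      have hprod : ∏ β with β ∉ α :: l, (((e + symbolExponent d φ α i) (β, 1)).factorial : K) •
          letterVar K d (φ β) ((e + symbolExponent d φ α i) (β, 1)) =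
          ∏ β with β ∉ α :: l, ((e (β, 1)).factorial : K) • letterVar K d (φ β) (e (β, 1)) :=
        Finset.prod_congr rfl fun β hβm => by rw [hβ β (by rintro rfl; simp at hβm)]
      rw [hset, Finset.prod_insert (by simp), hα, hprod]
      have hcomp := pderiv_weightedHomogeneousComponent (multidegree d) c (⟨φ α, i⟩ : Var d) F
      rw [show multidegree d ⟨φ α, i⟩ = Pi.single (φ α) 1 from rfl] at hcomp
      rw [hcomp, letterVar, dif_pos i.2, smul_mul_assoc, smul_mul_assoc, smul_smul]
      have hi : (((i : ℕ).factorial : K)) ≠ 0 := Nat.cast_ne_zero.mpr (Nat.factorial_ne_zero _)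
      congr 1
      · field_simp
        rfl
      · ring
    rw [polarize_cons, Finset.mul_sum, map_sum, Finset.sum_congr rfl fun i _ => hterm i,
      ← Finset.smul_sum, ← Finset.mul_sum, sum_X_mul_pderiv_multidegree
        (weightedHomogeneousComponent_isWeightedHomogeneous _ _), hc', hfact, mul_smul_comm, ← Nat.cast_smul_eq_nsmul K, smul_smul]
    congr 1
    simp
    ring

end Weitzenboeck

/-! ### The map Λ and the Weitzenböck derivation -/

theorem Derivation.apply_prod {R A M ι : Type*} [CommSemiring R] [CommSemiring A]
    [AddCommMonoid M] [Algebra R A] [Module A M] [Module R M] [DecidableEq ι]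
    (D : Derivation R A M) (s : Finset ι) (f : ι → A) :
    D (∏ i ∈ s, f i) = ∑ i ∈ s, (∏ j ∈ s.erase i, f j) • D (f i) := by
  induction s using Finset.induction_on with
  | empty => simp
  | insert a s ha ih =>
    rw [Finset.prod_insert ha, D.leibniz, ih, Finset.sum_insert ha, Finset.erase_insert ha,
      Finset.smul_sum, add_comm]
    congr 1
    refine Finset.sum_congr rfl fun i hi => ?_
    have hia : a ≠ i := by rintro rfl; exact ha hi
    rw [Finset.erase_insert_of_ne hia, Finset.prod_insert (by simp [ha]), smul_smul]

namespace Weitzenboeck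
variable {K J : Type*} [Field K] {s : ℕ} {d : Fin s → ℕ}

@[simp] theorem derivation_letterVar_zero (i : Fin s) :
    derivation K d (letterVar K d i 0) = 0 := by
  rw [letterVar, dif_pos (Nat.succ_pos _)]
  exact derivation_X_zero i

theorem derivation_letterVar_succ (i : Fin s) {j : ℕ} (hj : j < d i) :
    derivation K d (letterVar K d i (j + 1)) = letterVar K d i j := by
  rw [letterVar, letterVar, dif_pos (by omega), dif_pos (by omega)]
  exact derivation_X_succ i ⟨j, hj⟩

theorem lambdaMap_evalSymbol_leadingSymbol [Fintype J] (φ : J → Fin s) :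
    lambdaMap d φ (evalSymbol K J (leadingSymbol K d φ)) = ∏ α, X ⟨φ α, 0⟩ := by
  have h : evalSymbol K J (leadingSymbol K d φ) =
      monomial (∑ α : J, Finsupp.single (α, 0) (d (φ α))) 1 := by
    rw [monomial_sum_one, leadingSymbol, map_prod]
    refine Finset.prod_congr rfl fun α _ => ?_
    rw [map_pow, ← X_pow_eq_monomial]
    simp [evalSymbol]
  rw [h, lambdaMap_monomial, one_smul]
  refine Finset.prod_congr rfl fun α _ => ?_
  have : (∑ β : J, Finsupp.single (β, 0) (d (φ β)) : J × Fin 2 →₀ ℕ) (α, 1) = 0 := by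
    rw [Finsupp.finsetSum_apply]
    simp
  rw [this, letterVar, dif_pos (Nat.succ_pos _)]
  simp

variable [DecidableEq J]

theorem isWeightedHomogeneous_letterDegree_evalSymbol {P : SymbolicExpr K J} {δ : J → ℕ}
    (hP : IsWeightedHomogeneous symbolWeight P δ) :
    IsWeightedHomogeneous (fun v : J × Fin 2 => (Pi.single v.1 1 : J → ℕ))
      (evalSymbol K J P) δ := by
  induction hP using IsWeightedHomogeneous.induction_on with
  | zero => simpa using isWeightedHomogeneous_zero K _ _
  | add p q _ _ hp hq => simpa using hp.add hq
  | monomial e r he =>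
    have h := (isWeightedHomogeneous_evalSymbol (isWeightedHomogeneous_monomial
      symbolTorusWeight e r rfl)).map_weight (AddMonoidHom.fst (J → ℕ) ℤ)
    -- Coefficient 1 instead of `r`, which may vanish: homogeneity read at the exponent `e` itself
    -- identifies the two weights.
    have h' := ((isWeightedHomogeneous_monomial (R := K) symbolTorusWeight e 1 rfl).map_weight
      (AddMonoidHom.fst (J → ℕ) ℤ)) (d := e) (by simp)
    rw [← h'] at h
    rw [← he]
    exact h

variable [Fintype J]

/-- Raising turns `α_1 ^ k` into `k * α_1 ^ (k - 1) * α_0`, and `k * (k - 1)! = k!`: this is why Λ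
carries factorials. -/
theorem derivation_lambdaMap (φ : J → Fin s) {f : MvPolynomial (J × Fin 2) K}
    (hf : IsWeightedHomogeneous (fun v : J × Fin 2 => (Pi.single v.1 1 : J → ℕ)) f (d ∘ φ)) :
    derivation K d (lambdaMap d φ f) = lambdaMap d φ (raising K J f) := by
  induction hf using IsWeightedHomogeneous.induction_on with
  | zero => simp
  | add p q _ _ hp hq => simp [hp, hq]
  | monomial e r he =>
    -- The bound matters because `letterVar` is 0 beyond index `d`, where the relation `x_{j+1} ↦
    -- x_j` breaks down.
    have hle : ∀ α, e (α, 1) ≤ d (φ α) := by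
      intro α
      have h := congrFun he α
      rw [Finsupp.weight_eq_sum, Fintype.sum_prod_type] at h
      simp [Pi.single_apply, Finset.sum_add_distrib] at h
      omega
    rw [raising, mkDerivation_monomial, Finsupp.sum_fintype _ _ (by simp), lambdaMap_monomial,
      Derivation.map_smul, map_smul, Derivation.apply_prod, Fintype.sum_prod_type, map_sum]
    congr 1
    refine Finset.sum_congr rfl fun α _ => ?_
    rw [Fin.sum_univ_two]
    simp only [Fin.isValue, zero_ne_one, if_false, if_true, smul_zero, zero_add]
    rcases Nat.eq_zero_or_pos (e (α, 1)) with h0 | hpos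
    · simp [h0]
    obtain ⟨k, hk⟩ := Nat.exists_eq_add_of_le' hpos
    rw [smul_eq_mul, smul_eq_mul, X, monomial_mul, lambdaMap_monomial, mul_one, hk,
      ← Finset.mul_prod_erase _ _ (Finset.mem_univ α)]
    set e' : J × Fin 2 →₀ ℕ := e - Finsupp.single (α, 1) 1 + Finsupp.single (α, 0) 1 with he'
    have hprod : ∏ β ∈ Finset.univ.erase α,
        ((e' (β, 1)).factorial : K) • letterVar K d (φ β) (e' (β, 1)) =
        ∏ β ∈ Finset.univ.erase α, ((e (β, 1)).factorial : K) • letterVar K d (φ β) (e (β, 1)) := by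
      refine Finset.prod_congr rfl fun β hβ => ?_
      have : e' (β, 1) = e (β, 1) := by simp [he', (Finset.ne_of_mem_erase hβ).symm]
      rw [this]
    have hα : e' (α, 1) = k := by simp [he', hk]
    rw [hprod, hα, Derivation.map_smul, derivation_letterVar_succ _ (by have := hle α; omega),
      mul_comm, smul_mul_assoc, smul_mul_assoc, smul_smul, Nat.factorial_succ, Nat.cast_mul]

theorem lambdaMap_evalSymbol_mem_kernel (φ : J → Fin s) {P : SymbolicExpr K J}
    (hP : IsWeightedHomogeneous symbolWeight P (d ∘ φ)) :
    lambdaMap d φ (evalSymbol K J P) ∈ kernel K d := by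
  change derivation K d _ = 0
  rw [derivation_lambdaMap φ (isWeightedHomogeneous_letterDegree_evalSymbol hP),
    raising_evalSymbol, map_zero]

theorem isWeightedHomogeneous_leadingSymbol (φ : J → Fin s) :
    IsWeightedHomogeneous symbolWeight (leadingSymbol K d φ) (d ∘ φ) := by
  have h := IsWeightedHomogeneous.prod Finset.univ
    (fun α : J => (X (Sum.inr α) : SymbolicExpr K J) ^ d (φ α)) (fun α => d (φ α) • Pi.single α 1)
    (w := symbolWeight) fun α _ => (isWeightedHomogeneous_X K symbolWeight (Sum.inr α)).pow _
  have hδ : ∑ α, d (φ α) • (Pi.single α 1 : J → ℕ) = d ∘ φ := by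
    ext β
    simp [Pi.single_apply]
  exact hδ ▸ h

/-! ### Symbolic representations of kernel elements and the conclusion -/

theorem exists_mem_span_lambdaMap_eq_component [CharZero K] {F : MvPolynomial (Var d) K}
    (hF : F ∈ kernel K d) (φ : J → Fin s) :
    ∃ Φ ∈ Submodule.span K {Q : SymbolicExpr K J | IsConvolution (leadingSymbol K d φ) Q},
      lambdaMap d φ (evalSymbol K J Φ) = weightedHomogeneousComponent (multidegree d)
        (fun i => (Finset.univ.filter fun α => φ α = i).card) F := by
  set l := (Finset.univ : Finset J).toList with hl
  have hcount : (fun i => (l.map φ).count i) =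
      fun i => (Finset.univ.filter fun α => φ α = i).card := by
    ext i
    rw [← Multiset.coe_count, ← Multiset.map_coe, hl, Finset.coe_toList, Multiset.count_map]
    simp [Finset.card, eq_comm]
  have hδ : (l.map fun α => (Pi.single α (d (φ α)) : J → ℕ)).sum = d ∘ φ := by
    rw [hl, Finset.sum_map_toList]
    ext α
    simp [Pi.single_apply]
  have hw := isWeightedHomogeneous_polarize φ l F
  have h0 : raising K J (polarize K d φ l F) = 0 := by
    rw [raising_polarize, show derivation K d F = 0 from hF, map_zero]
  rw [hδ] at hw
  obtain ⟨P, hP, hPF⟩ := exists_evalSymbol_eq_of_raising_eq_zero hw h0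
  -- With `l` listing all letters and `e = 0`, no leftover factors remain.
  have hΛ := lambdaMap_monomial_mul_polarize φ l (Finset.nodup_toList _) F 0 1 (by simp)
  rw [monomial_zero', C_1, one_mul, one_mul, hcount, ← hPF, Finset.filter_false_of_mem
    (by simp [hl]), Finset.prod_empty, one_mul] at hΛ
  set N : ℕ := ∏ i, ((l.map φ).count i).factorial with hN
  have hN0 : (N : K) ≠ 0 := Nat.cast_ne_zero.mpr
    (Finset.prod_ne_zero_iff.mpr fun i _ => Nat.factorial_ne_zero _)
  refine ⟨(N : K)⁻¹ • P, Submodule.smul_mem _ _ (mem_span_isConvolution d φ hP), ?_⟩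
  rw [map_smul, map_smul, hΛ, smul_smul, inv_mul_cancel₀ hN0, one_smul]

theorem exists_card_fiber_eq (c : Fin s → ℕ) :
    ∃ (n : ℕ) (φ : Fin n → Fin s), (fun i => (Finset.univ.filter fun α => φ α = i).card) = c := by
  let e := Fintype.equivFin (Σ i : Fin s, Fin (c i))
  refine ⟨_, fun α => (e.symm α).1, ?_⟩
  ext i
  rw [← Fintype.card_subtype, Fintype.card_congr (e.symm.subtypeEquiv (p := fun α =>
    (e.symm α).1 = i) (q := fun p => p.1 = i) fun _ => Iff.rfl),
    Fintype.card_congr (Equiv.sigmaSubtype i), Fintype.card_fin]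

theorem kernel_le_adjoin [CharZero K] : kernel K d ≤ Algebra.adjoin K
    {G | ∃ (n : ℕ) (φ : Fin n → Fin s) (Q : SymbolicExpr K (Fin n)),
      IsConvolution (leadingSymbol K d φ) Q ∧ lambdaMap d φ (evalSymbol K (Fin n) Q) = G} := by
  intro F hF
  rw [← sum_weightedHomogeneousComponent (multidegree d) F,
    finsum_eq_sum _ (weightedHomogeneousComponent_finsupp F)]
  refine Subalgebra.sum_mem _ fun c _ => ?_
  obtain ⟨n, φ, rfl⟩ := exists_card_fiber_eq c
  obtain ⟨Φ, hΦ, hΛ⟩ := exists_mem_span_lambdaMap_eq_component hF φ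
  rw [← hΛ]
  clear hΛ
  induction hΦ using Submodule.span_induction with
  | mem Q hQ => exact Algebra.subset_adjoin ⟨n, φ, Q, hQ, rfl⟩
  | zero => simp
  | add p q _ _ hp hq => simpa using add_mem hp hq
  | smul a p _ hp => simpa using Subalgebra.smul_mem _ hp a

theorem adjoin_le_lambdaConvAlgebra : Algebra.adjoin K
    {G | ∃ (n : ℕ) (φ : Fin n → Fin s) (Q : SymbolicExpr K (Fin n)),
      IsConvolution (leadingSymbol K d φ) Q ∧ lambdaMap d φ (evalSymbol K (Fin n) Q) = G} ≤
    lambdaConvAlgebra d (leadingAlgebra K d) := by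
  refine Algebra.adjoin_mono ?_
  rintro _ ⟨n, φ, Q, hQ, rfl⟩
  refine ⟨_, ?_, n, φ, leadingSymbol K d φ, Q, isWeightedHomogeneous_leadingSymbol φ, rfl, hQ, rfl⟩
  rw [lambdaMap_evalSymbol_leadingSymbol]
  exact Subalgebra.prod_mem _ fun α _ => Algebra.subset_adjoin ⟨φ α, rfl⟩

theorem lambdaConvAlgebra_le_kernel (T : Subalgebra K (MvPolynomial (Var d) K)) :
    lambdaConvAlgebra d T ≤ kernel K d := by
  refine Algebra.adjoin_le ?_
  rintro _ ⟨F, -, n, φ, P, Q, hP, -, hPQ, rfl⟩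
  exact lambdaMap_evalSymbol_mem_kernel φ (hPQ.isWeightedHomogeneous hP)

end Weitzenboeck

theorem mainTheorem3 (K : Type*) [Field K] [CharZero K] (s : ℕ) (d : Fin s → ℕ) :
    Weitzenboeck.kernel K d =
        Weitzenboeck.lambdaConvAlgebra d (Weitzenboeck.leadingAlgebra K d) ∧
      Weitzenboeck.kernel K d =
        Algebra.adjoin K
          {G | ∃ (n : ℕ) (φ : Fin n → Fin s) (Q : Weitzenboeck.SymbolicExpr K (Fin n)),
            Weitzenboeck.IsConvolution (Weitzenboeck.leadingSymbol K d φ) Q ∧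
            Weitzenboeck.lambdaMap d φ (Weitzenboeck.evalSymbol K (Fin n) Q) = G} ∧
      ∀ F ∈ Weitzenboeck.kernel K d, ∀ (n : ℕ) (φ : Fin n → Fin s),
        ∃ Φ ∈ Submodule.span K
            {Q : Weitzenboeck.SymbolicExpr K (Fin n) |
              Weitzenboeck.IsConvolution (Weitzenboeck.leadingSymbol K d φ) Q},
          Weitzenboeck.lambdaMap d φ (Weitzenboeck.evalSymbol K (Fin n) Φ) =
            MvPolynomial.weightedHomogeneousComponent (Weitzenboeck.multidegree d)
              (fun i => (Finset.univ.filter fun α => φ α = i).card) F := by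
  have h1 := Weitzenboeck.kernel_le_adjoin (K := K) (d := d)
  have h2 := Weitzenboeck.adjoin_le_lambdaConvAlgebra (K := K) (d := d)
  have h3 := Weitzenboeck.lambdaConvAlgebra_le_kernel (Weitzenboeck.leadingAlgebra K d)
  exact ⟨le_antisymm (h1.trans h2) h3, le_antisymm h1 (h2.trans h3),
    fun _ hF _ φ => Weitzenboeck.exists_mem_span_lambdaMap_eq_component hF φ⟩
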